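/- Let $G$ be a finite directed graph (loops and multiple edges allowed) with vertex set $\mathcal V$ and edge set $\mathcal E\neq\emptyset$, where the edge $e$ goes from $s(e)$ to $r(e)$. Assume that $G$ is strongly connected, that is, for all $u,w\in\mathcal V$ there is a (possibly empty) directed path from $u$ to $w$. Let $A_G(u,v)$ be the number of edges from $u$ to $v$. The graph inverse semigroup of $G$ is the semigroup with zero generated by $P_v$ $(v\in\mathcal V)$ and $e^-,e^+$ $(e\in\mathcal E)$ with the relations $$P_u^2=P_u,\quad P_uP_w=0\ (u\ne w),\quad P_{s(e)}e^-=e^-=e^-P_{r(e)},\quad P_{r(e)}e^+=e^+=e^+P_{s(e)},$$ $$f^-f^+=P_{s(f)},\qquad f^-g^+=0\ (f\neq g).$$ The Markov-Dyck shift $D_G$ is the set of bi-infinite sequences in the letters $e^-,e^+$ $(e\in\mathcal E)$ all of whose finite subwords have non-zero product. Let $\mathcal L_n(D_G)$ be the set of words of length $n$ that appear in points of $D_G$. The topological entropy of $D_G$ is $h(D_G)=\lim_{n\to\infty}\frac1n\log\operatorname{card}\mathcal L_n(D_G)$. For $v\in\mathcal V$ let $\mathcal C_v$ be the set of non-empty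 words $c=(c_k)_{1\le k\le K}$ in these letters with $\prod_{1\le k\le K}c_k=P_v$ and $\prod_{1\le k\le J}c_k\ne P_v$ for $1\le J<K$. Let $\mathcal C_v^*$ be the set of all (possibly empty) concatenations of words in $\mathcal C_v$, and let $$g_{\mathcal C_v^*}(z)=\sum_{n\ge0}\operatorname{card}\{w\in\mathcal C_v^*:\ell(w)=n\}\,z^n ,$$ where $\ell(w)$ is the length of $w$. Let $D^*(A_G,z)$ be the diagonal matrix with entries $g_{\mathcal C_v^*}(z)$, $v\in\mathcal V$. Then the limit $h(D_G)$ exists. Moreover, among the real numbers $z>0$ at which all the series $g_{\mathcal C_v^*}(z)$, $v\in\mathcal V$, converge and for which $$\det\bigl(I-D^*(A_G,z)A_G\,z\bigr)=0,$$ there is a smallest one, $z_0$, and $h(D_G)=-\log z_0$. -/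

import Mathlib

open Filter Topology Computability

/-- The number of words of length `n` in the language `L`. -/
noncomputable def langCount {A : Type*} (L : Language A) (n : ℕ) : ℕ :=
  {w : List A | w ∈ L ∧ w.length = n}.ncard

/-- The power series `g_L` converges at `z`. -/
def GenFunConverges {A : Type*} (L : Language A) (z : ℝ) : Prop :=
  Summable fun n : ℕ => (langCount L n : ℝ) * z ^ n

/-- The value at `z` of the generating function
`g_L(z) = ∑ n, card {w ∈ L : ℓ(w) = n} z ^ n`; it is used only where the series converges. -/
noncomputable def genFun {A : Type*} (L : Language A) (z : ℝ) : ℝ :=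
  ∑' n : ℕ, (langCount L n : ℝ) * z ^ n

/-- The word `x_{[i, i + n)}` of a bi-infinite sequence. -/
def factorWord {A : Type*} (x : ℤ → A) (i : ℤ) (n : ℕ) : List A :=
  List.ofFn fun k : Fin n => x (i + (k : ℕ))

/-- The language of words that appear somewhere in a point of `X`. -/
def shiftLanguage {A : Type*} (X : Set (ℤ → A)) : Language A :=
  {w : List A | ∃ x ∈ X, ∃ (i : ℤ) (n : ℕ), w = factorWord x i n}

/-- `h` is the topological entropy of `X`: the limit
`lim (1 / n) log card L_n(X)` exists and equals `h`. -/
def HasTopEntropy {A : Type*} (X : Set (ℤ → A)) (h : ℝ) : Prop :=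
  Tendsto (fun n : ℕ => (1 / (n : ℝ)) * Real.log (langCount (shiftLanguage X) n : ℝ))
    atTop (𝓝 h)

/-- A directed graph with vertex set `V` and edge set `E` (loops and multiple edges allowed);
`s e` is the initial and `r e` the final vertex of the edge `e`. -/
structure DirGraph (V E : Type*) where
  s : E → V
  r : E → V

/-- The letters `e⁻` and `e⁺`, for `e` an edge: the alphabet of the Markov-Dyck shift. -/
inductive Letter (E : Type*) where
  | neg (e : E) : Letter E
  | pos (e : E) : Letter E

/-- Generators of the graph inverse semigroup: a zero, the idempotents `P_v`,
and the letters `e⁻`, `e⁺`. -/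
inductive Gen (V E : Type*) where
  | zero : Gen V E
  | idem (v : V) : Gen V E
  | letter (a : Letter E) : Gen V E

namespace DirGraph

variable {V E : Type*}

/-- `A_G(u, v)` is the number of edges from `u` to `v`. -/
noncomputable def adjMatrix (G : DirGraph V E) : Matrix V V ℝ :=
  Matrix.of fun u v => ({e : E | G.s e = u ∧ G.r e = v}.ncard : ℝ)

/-- From every vertex there is a directed path to every vertex. -/
def StronglyConnected (G : DirGraph V E) : Prop :=
  ∀ u v : V, Relation.ReflTransGen (fun a b => ∃ e : E, G.s e = a ∧ G.r e = b) u v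

section Relations

/-- The generator `P_v`, as an element of the free monoid. -/
def fP (E : Type*) {V : Type*} (v : V) : FreeMonoid (Gen V E) := FreeMonoid.of (Gen.idem v)

/-- The generator `e⁻`, as an element of the free monoid. -/
def fNeg (V : Type*) {E : Type*} (e : E) : FreeMonoid (Gen V E) :=
  FreeMonoid.of (Gen.letter (Letter.neg e))

/-- The generator `e⁺`, as an element of the free monoid. -/
def fPos (V : Type*) {E : Type*} (e : E) : FreeMonoid (Gen V E) :=
  FreeMonoid.of (Gen.letter (Letter.pos e))

/-- The generator `0`, as an element of the free monoid. -/
def fZero (V E : Type*) : FreeMonoid (Gen V E) := FreeMonoid.of Gen.zero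

/-- The defining relations of the graph inverse semigroup. Here `e⁻` is a path of length one from
`s e` to `r e`, and `e⁺` a path of length one from `r e` to `s e`. The relations
`f⁻ g⁻ = 0` for `r f ≠ s g`, `g⁺ f⁻ = 0` for `s g ≠ s f`, and `g⁺ f⁺ = 0` for `s g ≠ r f`
follow from those listed. -/
inductive Rel (G : DirGraph V E) : FreeMonoid (Gen V E) → FreeMonoid (Gen V E) → Prop where
  | zero_mul (a : Gen V E) : Rel G (fZero V E * FreeMonoid.of a) (fZero V E)
  | mul_zero (a : Gen V E) : Rel G (FreeMonoid.of a * fZero V E) (fZero V E)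
  | idem_mul_self (u : V) : Rel G (fP E u * fP E u) (fP E u)
  | idem_mul_ne (u w : V) : u ≠ w → Rel G (fP E u * fP E w) (fZero V E)
  | source_neg (e : E) : Rel G (fP E (G.s e) * fNeg V e) (fNeg V e)
  | neg_range (e : E) : Rel G (fNeg V e * fP E (G.r e)) (fNeg V e)
  | range_pos (e : E) : Rel G (fP E (G.r e) * fPos V e) (fPos V e)
  | pos_source (e : E) : Rel G (fPos V e * fP E (G.s e)) (fPos V e)
  | neg_pos_self (f : E) : Rel G (fNeg V f * fPos V f) (fP E (G.s f))
  | neg_pos_ne (f g : E) : f ≠ g → Rel G (fNeg V f * fPos V g) (fZero V E)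

end Relations

/-- The graph inverse semigroup of `G`, with an identity adjoined (the value of the empty word).
No relation involves the identity, so the semigroup itself sits inside as the set of values of
non-empty words. -/
abbrev InvSemigroup (G : DirGraph V E) : Type _ := PresentedMonoid G.Rel

/-- The zero of the graph inverse semigroup. -/
def zeroElt (G : DirGraph V E) : G.InvSemigroup := PresentedMonoid.of G.Rel Gen.zero

/-- The idempotent `P_v` of the graph inverse semigroup. -/
def idemElt (G : DirGraph V E) (v : V) : G.InvSemigroup := PresentedMonoid.of G.Rel (Gen.idem v)

/-- The product `∏ e_k` of a word `(e_k)` in the letters `e⁻`, `e⁺`. -/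
def wordProd (G : DirGraph V E) (w : List (Letter E)) : G.InvSemigroup :=
  (w.map fun a => PresentedMonoid.of G.Rel (Gen.letter a)).prod

/-- The Markov-Dyck shift `D_G`: the bi-infinite sequences of letters
all of whose finite subwords have a non-zero product. -/
def markovDyck (G : DirGraph V E) : Set (ℤ → Letter E) :=
  {x | ∀ (i : ℤ) (n : ℕ), G.wordProd (factorWord x i n) ≠ G.zeroElt}

/-- The Markov-Dyck code `C_v`: the non-empty words with product `P_v`
no proper non-empty prefix of which has product `P_v`. -/
def dyckCode (G : DirGraph V E) (v : V) : Language (Letter E) :=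
  {c : List (Letter E) | c ≠ [] ∧ G.wordProd c = G.idemElt v ∧
    ∀ J : ℕ, 1 ≤ J → J < c.length → G.wordProd (c.take J) ≠ G.idemElt v}

/-- The diagonal matrix `D^*(A_G, z)`, whose entries are the values at `z` of the generating
functions of the languages `C_v^*` of all (possibly empty) concatenations of words in `C_v`. -/
noncomputable def dStar [DecidableEq V] (G : DirGraph V E) (z : ℝ) : Matrix V V ℝ :=
  Matrix.diagonal fun v => genFun ((G.dyckCode v)∗) z

/-- The positive solutions of `det (I - D^*(A_G, z) A_G z) = 0`: the numbers `z > 0` at which all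
entries of `D^*(A_G, z)` are defined, that is, given by convergent series, and at which the
determinant vanishes. -/
def positiveSolutions [Fintype V] [DecidableEq V] (G : DirGraph V E) : Set ℝ :=
  {z : ℝ | 0 < z ∧ (∀ v : V, GenFunConverges ((G.dyckCode v)∗) z) ∧
    Matrix.det (1 - G.dStar z * (z • G.adjMatrix)) = 0}

end DirGraph

/-! Words with non-zero product are described by a deterministic stack automaton: `e⁻` pushes `e`,
and `e⁺` pops it. For a vertex `u`, let `D_u(z)` count the words leading from the empty stack at `u`
back to it, and `W_u(z)` the words readable from the empty stack at `u`. Cutting a Dyck word at its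
shortest non-empty prefixes with product `P_u` shows that `D_u` is the series of `C_u^*`
(`kstar_dyckCode`).

A non-empty readable word starts with some `e⁻`, which is either never cancelled or cancelled after
a Dyck word at `r e`. This unique decomposition gives `D_u = 1 + z² (∑ D_{r e}) D_u` and `W_u = 1 +
z ∑ W_{r e} + z² (∑ D_{r e}) W_u`, with sums over the edges leaving `u`. Eliminating the common
factor yields `(I - D^* A z) W = D`, where `W` and `D` are the vectors of these series.

Readable words occur in the shift, and each word of the shift is a reversed readable word followed
by a readable word with the same base vertex (`exists_flipWord_append`). Hence each `W_u` is at most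
the series of the shift language, which is at most `∑ W_u²`. By Fekete's lemma the language series
converges on `(0, e^{-h})` and diverges at `e^{-h}`.

Below `e^{-h}` all `W_u` are finite, and `W - D^* A z W = D > 0` forces a non-zero determinant,
since `D^* A z` is non-negative. At `e^{-h}` the `D_u` still converge, because `D_{r e} ≤ z⁻²`. Were
the determinant non-zero there, Cramer's rule would keep the `W_u` bounded up to `e^{-h}`, and the
language series would converge at that point. So the determinant vanishes first at `z_0 = e^{-h}`.
-/

open scoped ENNReal Matrix

/-! ### The stack automaton and its runs -/

namespace DirGraph

variable {V E : Type*}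

/-- The pushdown automaton reading words of the Markov-Dyck shift. A state consists of the current
vertex and of the stack of edges that are still to be cancelled. -/
inductive Step (G : DirGraph V E) : V × List E → Letter E → V × List E → Prop where
  | neg (e : E) (l : List E) : Step G (G.s e, l) (Letter.neg e) (G.r e, e :: l)
  | pos (e : E) (l : List E) : Step G (G.r e, e :: l) (Letter.pos e) (G.s e, l)

/-- The automaton reads the word `w` on its way from one state to another. -/
def Run (G : DirGraph V E) : V × List E → List (Letter E) → V × List E → Prop
  | s, [], t => s = t
  | s, a :: w, t => ∃ m, G.Step s a m ∧ Run G m w t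

variable {G : DirGraph V E}

theorem step_neg_iff {v : V} {l : List E} {e : E} {t : V × List E} :
    G.Step (v, l) (Letter.neg e) t ↔ v = G.s e ∧ t = (G.r e, e :: l) := by
  constructor
  · rintro ⟨⟩; exact ⟨rfl, rfl⟩
  · rintro ⟨rfl, rfl⟩; exact Step.neg e l

theorem step_pos_iff {v : V} {l : List E} {e : E} {t : V × List E} :
    G.Step (v, l) (Letter.pos e) t ↔ v = G.r e ∧ ∃ l', l = e :: l' ∧ t = (G.s e, l') := by
  constructor
  · rintro ⟨⟩; exact ⟨rfl, _, rfl, rfl⟩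
  · rintro ⟨rfl, l', rfl, rfl⟩; exact Step.pos e l'

theorem Step.unique {s t t' : V × List E} {a : Letter E} (h : G.Step s a t) (h' : G.Step s a t') :
    t = t' := by
  cases h with
  | neg e l => exact (step_neg_iff.1 h').2.symm
  | pos e l =>
    obtain ⟨-, l', hl, rfl⟩ := step_pos_iff.1 h'
    rw [(List.cons.inj hl).2]

@[simp] theorem run_nil {s t : V × List E} : G.Run s [] t ↔ s = t := Iff.rfl

theorem run_cons {s t : V × List E} {a : Letter E} {w : List (Letter E)} :
    G.Run s (a :: w) t ↔ ∃ m, G.Step s a m ∧ G.Run m w t := Iff.rfl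

theorem run_append {s t : V × List E} {w w' : List (Letter E)} :
    G.Run s (w ++ w') t ↔ ∃ m, G.Run s w m ∧ G.Run m w' t := by
  induction w generalizing s with
  | nil => simp
  | cons a w ih =>
    simp only [List.cons_append, run_cons, ih]
    constructor
    · rintro ⟨m, h, k, h1, h2⟩; exact ⟨k, ⟨m, h, h1⟩, h2⟩
    · rintro ⟨k, ⟨m, h, h1⟩, h2⟩; exact ⟨m, h, k, h1, h2⟩

theorem Run.unique {s t t' : V × List E} {w : List (Letter E)} (h : G.Run s w t)
    (h' : G.Run s w t') : t = t' := by
  induction w generalizing s with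
  | nil => exact h.symm.trans h'
  | cons a w ih =>
    obtain ⟨m, h1, h2⟩ := h
    obtain ⟨m', h1', h2'⟩ := h'
    obtain rfl := h1.unique h1'
    exact ih h2 h2'

/-- The vertex over which the stack is built. -/
def baseVertex (G : DirGraph V E) : V → List E → V
  | v, [] => v
  | _, e :: l => baseVertex G (G.s e) l

theorem Step.baseVertex_eq {s t : V × List E} {a : Letter E} (h : G.Step s a t) :
    G.baseVertex s.1 s.2 = G.baseVertex t.1 t.2 := by
  cases h <;> rfl

/-- Pushing and popping never change what lies under the stack. In particular, a run from the empty
stack at `u` that ends with an empty stack ends at `u`. -/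
theorem Run.baseVertex_eq {s t : V × List E} {w : List (Letter E)} (h : G.Run s w t) :
    G.baseVertex s.1 s.2 = G.baseVertex t.1 t.2 := by
  induction w generalizing s with
  | nil => rw [run_nil.1 h]
  | cons a w ih =>
    obtain ⟨m, h1, h2⟩ := h
    rw [h1.baseVertex_eq, ih h2]

theorem Run.append_stack {s t : V × List E} {w : List (Letter E)} (h : G.Run s w t) (b : List E) :
    G.Run (s.1, s.2 ++ b) w (t.1, t.2 ++ b) := by
  induction w generalizing s with
  | nil => rw [run_nil.1 h]; rfl
  | cons a w ih =>
    obtain ⟨m, h1, h2⟩ := h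
    refine ⟨_, ?_, ih h2⟩
    cases h1
    · exact Step.neg _ _
    · exact Step.pos _ _

/-- A run over a base `b` of the stack either leaves `b` untouched, or it has a first moment at
which `b` is about to be used. -/
theorem Run.split_stack {v : V} {l b : List E} {t : V × List E} {w : List (Letter E)}
    (h : G.Run (v, l ++ b) w t) :
    (∃ l', t.2 = l' ++ b ∧ G.Run (v, l) w (t.1, l')) ∨
      ∃ w₁ e w₂ v', w = w₁ ++ Letter.pos e :: w₂ ∧ G.Run (v, l) w₁ (v', []) ∧
        G.Run (v', b) (Letter.pos e :: w₂) t := by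
  induction w generalizing v l with
  | nil =>
    rw [run_nil] at h
    subst h
    exact Or.inl ⟨l, rfl, rfl⟩
  | cons a w ih =>
    obtain ⟨m, h1, h2⟩ := h
    cases a with
    | neg e =>
      obtain ⟨rfl, rfl⟩ := step_neg_iff.1 h1
      rcases ih (l := e :: l) h2 with ⟨l', hl, hr⟩ | ⟨w₁, f, w₂, v', hw, hr, hr'⟩
      · exact Or.inl ⟨l', hl, _, Step.neg e l, hr⟩
      · exact Or.inr ⟨_ :: w₁, f, w₂, v', by rw [hw]; rfl, ⟨_, Step.neg e l, hr⟩, hr'⟩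
    | pos e =>
      cases l with
      | nil => exact Or.inr ⟨[], e, w, v, rfl, rfl, m, h1, h2⟩
      | cons f l =>
        obtain ⟨rfl, l', hl', rfl⟩ := step_pos_iff.1 h1
        obtain ⟨rfl, rfl⟩ := List.cons.inj hl'
        rcases ih (l := l) h2 with ⟨l', hl, hr⟩ | ⟨w₁, f, w₂, v', hw, hr, hr'⟩
        · exact Or.inl ⟨l', hl, _, Step.pos _ l, hr⟩
        · exact Or.inr ⟨_ :: w₁, f, w₂, v', by rw [hw]; rfl, ⟨_, Step.pos _ l, hr⟩, hr'⟩

/-! ### Dyck words, readable words and their decomposition -/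

/-- The words that are read from the empty stack at `u` back to the empty stack at `u`. -/
def dyckWords (G : DirGraph V E) (u : V) : Language (Letter E) :=
  {w : List (Letter E) | G.Run (u, []) w (u, [])}

/-- The words that can be read from the empty stack at `u`. -/
def readableWords (G : DirGraph V E) (u : V) : Language (Letter E) :=
  {w : List (Letter E) | ∃ t, G.Run (u, []) w t}

theorem mem_dyckWords {u : V} {w : List (Letter E)} :
    w ∈ G.dyckWords u ↔ G.Run (u, []) w (u, []) := Iff.rfl

theorem nil_mem_dyckWords (u : V) : [] ∈ G.dyckWords u := rfl

theorem dyckWords_subset_readableWords {u : V} {w : List (Letter E)} (h : w ∈ G.dyckWords u) :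
    w ∈ G.readableWords u := ⟨_, h⟩

theorem append_mem_dyckWords {u : V} {w w' : List (Letter E)} (h : w ∈ G.dyckWords u)
    (h' : w' ∈ G.dyckWords u) : w ++ w' ∈ G.dyckWords u :=
  run_append.2 ⟨_, h, h'⟩

theorem run_wrap {e : E} {d w : List (Letter E)} {t : V × List E} (hd : d ∈ G.dyckWords (G.r e))
    (hw : G.Run (G.s e, []) w t) :
    G.Run (G.s e, []) (Letter.neg e :: (d ++ Letter.pos e :: w)) t :=
  ⟨_, Step.neg e [], run_append.2 ⟨_, hd.append_stack [e], _, Step.pos e [], hw⟩⟩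

/-- A non-empty word read from the empty stack begins with a letter `e⁻`, which either is never
cancelled, or is cancelled after a Dyck word at the range of `e`. -/
theorem Run.cases_nil {u : V} {a : Letter E} {w : List (Letter E)} {t : V × List E}
    (h : G.Run (u, []) (a :: w) t) :
    ∃ e, a = Letter.neg e ∧ u = G.s e ∧
      ((∃ l, t.2 = l ++ [e] ∧ G.Run (G.r e, []) w (t.1, l)) ∨
        ∃ d w', w = d ++ Letter.pos e :: w' ∧ d ∈ G.dyckWords (G.r e) ∧ G.Run (u, []) w' t) := by
  obtain ⟨m, h1, h2⟩ := h
  cases h1 with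
  | neg e =>
    refine ⟨e, rfl, rfl, ?_⟩
    rcases Run.split_stack (l := []) (b := [e]) h2 with h3 | ⟨w₁, f, w₂, v', rfl, hr, m, hs, hr'⟩
    · exact Or.inl h3
    · right
      obtain ⟨rfl, l', hl', rfl⟩ := step_pos_iff.1 hs
      obtain ⟨rfl, rfl⟩ := List.cons.inj hl'
      exact ⟨w₁, w₂, rfl, hr, hr'⟩

/-- By determinism the stack is empty after `d`, so `e⁺` has nothing to cancel. This makes the
decomposition by the first letter unique. -/
theorem not_readable_append_pos {u : V} {d x : List (Letter E)} {e : E} (hd : d ∈ G.dyckWords u) :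
    d ++ Letter.pos e :: x ∉ G.readableWords u := by
  rintro ⟨t, ht⟩
  obtain ⟨m, h1, m', h2, -⟩ := run_append.1 ht
  obtain rfl := h1.unique hd
  obtain ⟨-, l', hl, -⟩ := step_pos_iff.1 h2
  simp at hl

/-- If one of `d`, `d'` were strictly longer, it would be a readable word starting with the other
followed by `e⁺`. -/
theorem dyck_append_pos_inj {u : V} {d d' x x' : List (Letter E)} {e : E}
    (hd : d ∈ G.dyckWords u) (hd' : d' ∈ G.dyckWords u)
    (h : d ++ Letter.pos e :: x = d' ++ Letter.pos e :: x') : d = d' ∧ x = x' := by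
  rcases List.append_eq_append_iff.1 h with ⟨a, h1, h2⟩ | ⟨a, h1, h2⟩
  · cases a with
    | nil => simp_all
    | cons b a =>
      obtain ⟨rfl, -⟩ := List.cons.inj h2
      exact absurd (h1 ▸ dyckWords_subset_readableWords hd') (not_readable_append_pos hd)
  · cases a with
    | nil => simp_all
    | cons b a =>
      obtain ⟨rfl, -⟩ := List.cons.inj h2
      exact absurd (h1 ▸ dyckWords_subset_readableWords hd) (not_readable_append_pos hd')

/-- Exchange `e⁻` and `e⁺`. -/
def swapLetter : Letter E → Letter E
  | Letter.neg e => Letter.pos e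
  | Letter.pos e => Letter.neg e

/-- Read a word backwards, exchanging `e⁻` and `e⁺`. -/
def flipWord (w : List (Letter E)) : List (Letter E) := (w.map swapLetter).reverse

theorem flipWord_flipWord (w : List (Letter E)) : flipWord (flipWord w) = w := by
  have h : ∀ a : Letter E, swapLetter (swapLetter a) = a := by rintro (_ | _) <;> rfl
  simp [flipWord, ← List.map_reverse, Function.comp_def, h]

theorem length_flipWord (w : List (Letter E)) : (flipWord w).length = w.length := by
  simp [flipWord]

/-- Induction on the length: flipping `e⁻ d e⁺ w'` gives the flip of `w'` followed by `e⁻`, the flip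
of `d`, and `e⁺`. -/
theorem flipWord_mem_dyckWords {u : V} {w : List (Letter E)} (h : w ∈ G.dyckWords u) :
    flipWord w ∈ G.dyckWords u := by
  induction hn : w.length using Nat.strong_induction_on generalizing w u with
  | _ n ih =>
    cases w with
    | nil => exact h
    | cons a w =>
      obtain ⟨e, rfl, rfl, ⟨l, hl, -⟩ | ⟨d, w', rfl, hd, hw'⟩⟩ := Run.cases_nil h
      · simp at hl
      · have h1 := ih d.length (by simp at hn; omega) hd rfl
        have h2 := ih w'.length (by simp at hn; omega) hw' rfl
        have h3 : flipWord (Letter.neg e :: (d ++ Letter.pos e :: w')) =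
            flipWord w' ++ (Letter.neg e :: (flipWord d ++ Letter.pos e :: [])) := by
          simp [flipWord, swapLetter]
        rw [h3]
        exact append_mem_dyckWords h2 (run_wrap h1 rfl)

/-! ### Products in the graph inverse semigroup versus runs -/

section Semigroup

theorem wordProd_nil : G.wordProd [] = 1 := rfl

theorem wordProd_cons (a : Letter E) (w : List (Letter E)) :
    G.wordProd (a :: w) = G.wordProd [a] * G.wordProd w := by
  simp [wordProd]

theorem wordProd_append (w w' : List (Letter E)) :
    G.wordProd (w ++ w') = G.wordProd w * G.wordProd w' := by
  simp [wordProd]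

theorem mk_eq {x y : FreeMonoid (Gen V E)} (h : G.Rel x y) :
    PresentedMonoid.mk G.Rel x = PresentedMonoid.mk G.Rel y :=
  PresentedMonoid.mk_eq_mk_of_rel h

theorem wordProd_singleton (a : Letter E) :
    G.wordProd [a] = PresentedMonoid.of G.Rel (Gen.letter a) := by
  simp [wordProd]

theorem zeroElt_mul (x : G.InvSemigroup) : G.zeroElt * x = G.zeroElt := by
  induction x using PresentedMonoid.inductionOn with
  | _ x =>
    induction x with
    | one => exact mul_one _
    | of a => exact mk_eq (Rel.zero_mul a)
    | mul x y hx hy => rw [map_mul, ← mul_assoc, hx, hy]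

theorem mul_zeroElt (x : G.InvSemigroup) : x * G.zeroElt = G.zeroElt := by
  induction x using PresentedMonoid.inductionOn with
  | _ x =>
    induction x with
    | one => exact one_mul _
    | of a => exact mk_eq (Rel.mul_zero a)
    | mul x y hx hy => rw [map_mul, mul_assoc, hy, hx]

theorem idemElt_mul_neg (e : E) :
    G.idemElt (G.s e) * G.wordProd [Letter.neg e] = G.wordProd [Letter.neg e] := by
  rw [wordProd_singleton]; exact mk_eq (Rel.source_neg e)

theorem neg_mul_idemElt (e : E) :
    G.wordProd [Letter.neg e] * G.idemElt (G.r e) = G.wordProd [Letter.neg e] := by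
  rw [wordProd_singleton]; exact mk_eq (Rel.neg_range e)

theorem idemElt_mul_pos (e : E) :
    G.idemElt (G.r e) * G.wordProd [Letter.pos e] = G.wordProd [Letter.pos e] := by
  rw [wordProd_singleton]; exact mk_eq (Rel.range_pos e)

theorem pos_mul_idemElt (e : E) :
    G.wordProd [Letter.pos e] * G.idemElt (G.s e) = G.wordProd [Letter.pos e] := by
  rw [wordProd_singleton]; exact mk_eq (Rel.pos_source e)

theorem idemElt_mul_ne {u v : V} (h : u ≠ v) : G.idemElt u * G.idemElt v = G.zeroElt :=
  mk_eq (Rel.idem_mul_ne u v h)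

theorem idemElt_mul_self (u : V) : G.idemElt u * G.idemElt u = G.idemElt u :=
  mk_eq (Rel.idem_mul_self u)

theorem neg_mul_pos (e : E) :
    G.wordProd [Letter.neg e] * G.wordProd [Letter.pos e] = G.idemElt (G.s e) := by
  simp only [wordProd_singleton]; exact mk_eq (Rel.neg_pos_self e)

theorem neg_mul_pos_ne {e f : E} (h : e ≠ f) :
    G.wordProd [Letter.neg e] * G.wordProd [Letter.pos f] = G.zeroElt := by
  simp only [wordProd_singleton]; exact mk_eq (Rel.neg_pos_ne e f h)

theorem idemElt_mul_neg_ne {v : V} {e : E} (h : v ≠ G.s e) :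
    G.idemElt v * G.wordProd [Letter.neg e] = G.zeroElt := by
  rw [← idemElt_mul_neg, ← mul_assoc, idemElt_mul_ne h, zeroElt_mul]

theorem idemElt_mul_pos_ne {v : V} {e : E} (h : v ≠ G.r e) :
    G.idemElt v * G.wordProd [Letter.pos e] = G.zeroElt := by
  rw [← idemElt_mul_pos, ← mul_assoc, idemElt_mul_ne h, zeroElt_mul]

/-- The product of the edges `e⁻` on the stack. -/
def stackElt (G : DirGraph V E) : List E → G.InvSemigroup
  | [] => 1
  | e :: l => stackElt G l * G.wordProd [Letter.neg e]

/-- A state stands for the semigroup element "stack times vertex idempotent", and the automaton is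
right multiplication on such elements. -/
theorem Step.mul_eq {s t : V × List E} {a : Letter E} (h : G.Step s a t) :
    G.stackElt s.2 * G.idemElt s.1 * G.wordProd [a] = G.stackElt t.2 * G.idemElt t.1 := by
  cases h with
  | neg e l => simp only [stackElt, mul_assoc, idemElt_mul_neg, neg_mul_idemElt]
  | pos e l => simp only [stackElt, mul_assoc, idemElt_mul_pos, neg_mul_pos]

theorem Run.mul_eq {s t : V × List E} {w : List (Letter E)} (h : G.Run s w t) :
    G.stackElt s.2 * G.idemElt s.1 * G.wordProd w = G.stackElt t.2 * G.idemElt t.1 := by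
  induction w generalizing s with
  | nil => rw [run_nil.1 h, wordProd_nil, mul_one]
  | cons a w ih =>
    obtain ⟨m, h1, h2⟩ := h
    rw [wordProd_cons, ← mul_assoc, h1.mul_eq, ih h2]

theorem Run.idemElt_mul_eq {u : V} {t : V × List E} {w : List (Letter E)}
    (h : G.Run (u, []) w t) :
    G.idemElt u * G.wordProd w = G.stackElt t.2 * G.idemElt t.1 := by
  simpa [stackElt] using h.mul_eq

theorem Run.idemElt_mul_self {u : V} {t : V × List E} {w : List (Letter E)} (hw : w ≠ [])
    (h : G.Run (u, []) w t) : G.idemElt u * G.wordProd w = G.wordProd w := by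
  cases w with
  | nil => exact absurd rfl hw
  | cons a w =>
    obtain ⟨e, rfl, rfl, -⟩ := Run.cases_nil h
    rw [wordProd_cons, ← mul_assoc, idemElt_mul_neg]

/-- The action of the generators on sets of states. -/
def genAct (G : DirGraph V E) : Gen V E → Function.End (Set (V × List E))
  | Gen.zero => fun _ => ∅
  | Gen.idem v => fun T => {s | s ∈ T ∧ s.1 = v}
  | Gen.letter a => fun T => {t | ∃ s ∈ T, G.Step s a t}

/-- Words are read from left to right, so the first factor acts first; this is why the opposite
monoid appears. The resulting representation is what proves elements of the presented monoid
distinct. -/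
theorem genAct_rel (x y : FreeMonoid (Gen V E)) (h : G.Rel x y) :
    FreeMonoid.lift (fun g => MulOpposite.op (G.genAct g)) x =
      FreeMonoid.lift (fun g => MulOpposite.op (G.genAct g)) y := by
  cases h <;>
    simp only [fP, fNeg, fPos, fZero, map_mul, FreeMonoid.lift_eval_of, ← MulOpposite.op_mul] <;>
    congr 1 <;> funext T
  case zero_mul a =>
    ext t
    cases a
    · exact Iff.rfl
    · exact ⟨fun h => h.1, fun h => h.elim⟩
    · exact ⟨fun ⟨_, hs, _⟩ => hs, fun h => h.elim⟩
  case idem_mul_self u =>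
    ext t
    exact ⟨fun h => h.1, fun h => ⟨h, h.2⟩⟩
  case idem_mul_ne u v huv =>
    ext t
    refine ⟨fun h => ?_, fun h => h.elim⟩
    exact (huv (h.1.2.symm.trans h.2)).elim
  case source_neg e =>
    ext t
    constructor
    · rintro ⟨s, ⟨hs, -⟩, h⟩; exact ⟨s, hs, h⟩
    · rintro ⟨s, hs, h⟩; exact ⟨s, ⟨hs, by cases h; rfl⟩, h⟩
  case neg_range e =>
    ext t
    constructor
    · rintro ⟨h, -⟩; exact h
    · rintro ⟨s, hs, h⟩; exact ⟨⟨s, hs, h⟩, by cases h; rfl⟩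
  case range_pos e =>
    ext t
    constructor
    · rintro ⟨s, ⟨hs, -⟩, h⟩; exact ⟨s, hs, h⟩
    · rintro ⟨s, hs, h⟩; exact ⟨s, ⟨hs, by cases h; rfl⟩, h⟩
  case pos_source e =>
    ext t
    constructor
    · rintro ⟨h, -⟩; exact h
    · rintro ⟨s, hs, h⟩; exact ⟨⟨s, hs, h⟩, by cases h; rfl⟩
  case neg_pos_self e =>
    ext ⟨v, l⟩
    constructor
    · rintro ⟨⟨v', l'⟩, ⟨⟨v₁, l₁⟩, hs, h⟩, h'⟩
      obtain ⟨rfl, hm⟩ := step_neg_iff.1 h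
      obtain ⟨rfl, rfl⟩ := Prod.mk.inj hm
      obtain ⟨-, l', hl, h'⟩ := step_pos_iff.1 h'
      obtain ⟨-, rfl⟩ := List.cons.inj hl
      rw [h']
      exact ⟨hs, rfl⟩
    · rintro ⟨ht, h⟩
      obtain rfl : v = G.s e := h
      exact ⟨_, ⟨_, ht, Step.neg e l⟩, Step.pos e l⟩
  case neg_pos_ne e f hef =>
    ext t
    refine ⟨?_, fun h => h.elim⟩
    rintro ⟨⟨v', l'⟩, ⟨⟨v₁, l₁⟩, hs, h⟩, h'⟩
    obtain ⟨rfl, hm⟩ := step_neg_iff.1 h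
    obtain ⟨rfl, rfl⟩ := Prod.mk.inj hm
    obtain ⟨-, l', hl, h'⟩ := step_pos_iff.1 h'
    exact (hef (List.cons.inj hl).1).elim

/-- The action of the graph inverse semigroup on sets of states. -/
def act (G : DirGraph V E) : G.InvSemigroup →* (Function.End (Set (V × List E)))ᵐᵒᵖ :=
  PresentedMonoid.lift (fun g => MulOpposite.op (G.genAct g)) genAct_rel

theorem act_wordProd (w : List (Letter E)) (T : Set (V × List E)) :
    (G.act (G.wordProd w)).unop T = {t | ∃ s ∈ T, G.Run s w t} := by
  induction w generalizing T with
  | nil => rw [wordProd_nil, map_one]; ext t; simp [Function.End.one_def]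
  | cons a w ih =>
    rw [wordProd_cons, map_mul]
    change (G.act (G.wordProd w)).unop ((G.act (G.wordProd [a])).unop T) = _
    rw [ih, wordProd_singleton]
    ext t
    change (∃ s, (∃ s' ∈ T, G.Step s' a s) ∧ G.Run s w t) ↔ _
    simp only [run_cons, Set.mem_ofPred_eq]
    constructor
    · rintro ⟨s, ⟨s', h, h1⟩, h2⟩; exact ⟨s', h, s, h1, h2⟩
    · rintro ⟨s', h, s, h1, h2⟩; exact ⟨s, ⟨s', h, h1⟩, h2⟩

/-- Zero sends every set of states to the empty set, while a word with a run does not. -/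
theorem wordProd_ne_zeroElt {s t : V × List E} {w : List (Letter E)} (h : G.Run s w t) :
    G.wordProd w ≠ G.zeroElt := by
  intro h0
  have h1 := act_wordProd (G := G) w {s}
  rw [h0] at h1
  have h2 : t ∈ (∅ : Set (V × List E)) := by
    change t ∈ (G.act G.zeroElt).unop {s}
    rw [h1]; exact ⟨s, rfl, h⟩
  exact h2

theorem run_of_wordProd_eq {u : V} {w : List (Letter E)} (h : G.wordProd w = G.idemElt u) :
    w ∈ G.dyckWords u := by
  have h1 := act_wordProd (G := G) w {(u, [])}
  rw [h] at h1
  have h2 : ((u, []) : V × List E) ∈ {t | ∃ s ∈ ({(u, [])} : Set (V × List E)), G.Run s w t} := by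
    rw [← h1]; exact ⟨rfl, rfl⟩
  obtain ⟨s, rfl, hs⟩ := h2
  exact hs

/-- The empty word is excluded because its value is the adjoined identity, not `P_u`. For a
non-empty Dyck word, `P_u` is absorbed by the first letter. -/
theorem wordProd_eq_idemElt_iff {u : V} {w : List (Letter E)} (hw : w ≠ []) :
    G.wordProd w = G.idemElt u ↔ w ∈ G.dyckWords u := by
  refine ⟨run_of_wordProd_eq, fun h => ?_⟩
  have := Run.idemElt_mul_eq h
  rw [Run.idemElt_mul_self hw h] at this
  simpa [stackElt] using this

/-- The shortest non-empty prefix with product `P_u` lies in the code, and by determinism the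
remainder is again a Dyck word at `u`; induct on the length. -/
theorem kstar_dyckCode (u : V) : (G.dyckCode u)∗ = G.dyckWords u := by
  ext w
  constructor
  · rw [Language.mem_kstar]
    rintro ⟨L, rfl, hL⟩
    induction L with
    | nil => exact nil_mem_dyckWords u
    | cons c L ih =>
      rw [List.flatten_cons]
      exact append_mem_dyckWords (run_of_wordProd_eq (hL c (by simp)).2.1)
        (ih fun y hy => hL y (by simp [hy]))
  · induction hn : w.length using Nat.strong_induction_on generalizing w with
    | _ n ih =>
      intro hw
      by_cases h0 : w = []
      · rw [h0]; exact Language.nil_mem_kstar _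
      · classical
        have hex : ∃ J, 1 ≤ J ∧ G.wordProd (w.take J) = G.idemElt u :=
          ⟨w.length, List.length_pos_iff.2 h0, by
            rw [List.take_length]; exact (wordProd_eq_idemElt_iff h0).2 hw⟩
        have hle : Nat.find hex ≤ w.length := Nat.find_min' hex ⟨List.length_pos_iff.2 h0, by
            rw [List.take_length]; exact (wordProd_eq_idemElt_iff h0).2 hw⟩
        obtain ⟨h1, h2⟩ := Nat.find_spec hex
        have hmin := fun m (hm : m < Nat.find hex) => Nat.find_min hex hm
        set J := Nat.find hex
        have h3 : w.drop J ∈ G.dyckWords u := by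
          rw [mem_dyckWords, ← List.take_append_drop J w, run_append] at hw
          obtain ⟨m, hm1, hm2⟩ := hw
          obtain rfl := hm1.unique (run_of_wordProd_eq h2)
          exact hm2
        have h4 := ih _ (by rw [List.length_drop]; omega) (w.drop J) rfl h3
        have h5 : w.take J ∈ G.dyckCode u := by
          refine ⟨?_, h2, fun K hK hK' => ?_⟩
          · rw [← List.length_pos_iff, List.length_take]; omega
          · rw [List.length_take] at hK'
            rw [List.take_take, min_eq_left (by omega)]
            exact fun h => hmin K (by omega) ⟨hK, h⟩
        rw [← List.take_append_drop J w]
        rw [Language.mem_kstar] at h4 ⊢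
        obtain ⟨L, hL, hL'⟩ := h4
        refine ⟨w.take J :: L, by rw [List.flatten_cons, ← hL], fun y hy => ?_⟩
        rcases List.mem_cons.1 hy with rfl | hy
        · exact h5
        · exact hL' y hy

/-- A word with non-zero product is a word in which no `e⁻` remains uncancelled, followed by a word
in which no `e⁺` remains uncancelled. -/
theorem exists_flipWord_append [Nonempty V] {w : List (Letter E)}
    (hw : G.wordProd w ≠ G.zeroElt) :
    ∃ u, ∃ p ∈ G.readableWords u, ∃ q ∈ G.readableWords u, w = flipWord p ++ q := by
  induction w using List.reverseRecOn with
  | nil =>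
    obtain ⟨u⟩ := ‹Nonempty V›
    exact ⟨u, [], ⟨_, rfl⟩, [], ⟨_, rfl⟩, rfl⟩
  | append_singleton w a ih =>
    rw [wordProd_append] at hw
    have hw' : G.wordProd w ≠ G.zeroElt := fun h => hw (by rw [h, zeroElt_mul])
    by_cases hnil : w = []
    · subst hnil
      cases a with
      | neg e => exact ⟨G.s e, [], ⟨_, rfl⟩, [Letter.neg e], ⟨_, _, Step.neg e [], rfl⟩, rfl⟩
      | pos e => exact ⟨G.s e, [Letter.neg e], ⟨_, _, Step.neg e [], rfl⟩, [], ⟨_, rfl⟩, rfl⟩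
    obtain ⟨u, p, ⟨t', hp⟩, q, ⟨t, hq⟩, rfl⟩ := ih hw'
    obtain ⟨v, l⟩ := t
    -- The idempotent at `u` can be inserted between the two factors: it is absorbed by the first
    -- letter of `q`, or, if `q` is empty, by the last letter of the flipped `p`.
    have hprod : G.wordProd (flipWord p ++ q) =
        G.wordProd (flipWord p) * (G.stackElt l * G.idemElt v) := by
      rw [← Run.idemElt_mul_eq hq, wordProd_append]
      by_cases hq0 : q = []
      · subst hq0
        cases p with
        | nil => exact absurd rfl hnil
        | cons b p =>
          obtain ⟨e, rfl, rfl, -⟩ := Run.cases_nil hp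
          have h1 : flipWord (Letter.neg e :: p) = flipWord p ++ [Letter.pos e] := by
            simp [flipWord, swapLetter]
          rw [h1, wordProd_append, wordProd_nil, mul_one, mul_one, mul_assoc, pos_mul_idemElt]
      · rw [Run.idemElt_mul_self hq0 hq]
    rw [hprod, mul_assoc, mul_assoc] at hw
    cases a with
    | neg e =>
      by_cases hv : v = G.s e
      · subst hv
        exact ⟨u, p, ⟨t', hp⟩, q ++ [Letter.neg e],
          ⟨_, run_append.2 ⟨_, hq, _, Step.neg e l, rfl⟩⟩, by simp⟩
      · rw [idemElt_mul_neg_ne hv] at hw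
        exact absurd (by rw [mul_zeroElt, mul_zeroElt]) hw
    | pos e =>
      by_cases hv : v = G.r e
      · subst hv
        cases l with
        | nil =>
          -- With an empty stack, `q` is a Dyck word and `e⁺` stays uncancelled. So the whole word
          -- moves into the left factor and the base vertex changes to `s e`.
          obtain rfl : u = G.r e := hq.baseVertex_eq
          refine ⟨G.s e, Letter.neg e :: (flipWord q ++ p), ⟨_, _, Step.neg e [], run_append.2
            ⟨_, Run.append_stack (flipWord_mem_dyckWords hq) [e], hp.append_stack [e]⟩⟩,
            [], ⟨_, rfl⟩, ?_⟩
          have h1 : flipWord (Letter.neg e :: (flipWord q ++ p)) =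
              flipWord p ++ flipWord (flipWord q) ++ [Letter.pos e] := by
            simp [flipWord, swapLetter]
          rw [h1, flipWord_flipWord, List.append_nil]
        | cons f l =>
          by_cases hf : f = e
          · subst hf
            exact ⟨u, p, ⟨t', hp⟩, q ++ [Letter.pos f],
              ⟨_, run_append.2 ⟨_, hq, _, Step.pos f l, rfl⟩⟩, by simp⟩
          · rw [idemElt_mul_pos, stackElt, mul_assoc, neg_mul_pos_ne hf] at hw
            exact absurd (by rw [mul_zeroElt, mul_zeroElt]) hw
      · rw [idemElt_mul_pos_ne hv] at hw
        exact absurd (by rw [mul_zeroElt, mul_zeroElt]) hw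

end Semigroup

end DirGraph

/-! ### Factors of bi-infinite sequences and submultiplicativity -/

section FactorWord

variable {A : Type*}

theorem factorWord_zero (x : ℤ → A) (i : ℤ) : factorWord x i 0 = [] := by
  simp [factorWord]

theorem factorWord_succ (x : ℤ → A) (i : ℤ) (n : ℕ) :
    factorWord x i (n + 1) = x i :: factorWord x (i + 1) n := by
  simp only [factorWord, List.ofFn_succ, Fin.val_zero, Fin.val_succ, Nat.cast_zero, add_zero,
    Nat.cast_add, Nat.cast_one, List.cons.injEq, true_and]
  congr 1
  funext k
  congr 1
  ring

theorem length_factorWord (x : ℤ → A) (i : ℤ) (n : ℕ) : (factorWord x i n).length = n := by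
  simp [factorWord]

theorem factorWord_add (x : ℤ → A) (i : ℤ) (m n : ℕ) :
    factorWord x i (m + n) = factorWord x i m ++ factorWord x (i + m) n := by
  induction m generalizing i with
  | zero => simp [factorWord_zero]
  | succ m ih =>
    rw [show m + 1 + n = m + n + 1 by ring, factorWord_succ, factorWord_succ, ih]
    rw [List.cons_append, add_assoc, add_comm 1 (m : ℤ), Nat.cast_add, Nat.cast_one]

theorem mem_shiftLanguage_length {X : Set (ℤ → A)} {w : List A} {n : ℕ} :
    w ∈ shiftLanguage X ∧ w.length = n ↔ ∃ x ∈ X, ∃ i, w = factorWord x i n := by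
  constructor
  · rintro ⟨⟨x, hx, i, m, rfl⟩, h⟩
    rw [length_factorWord] at h
    exact ⟨x, hx, i, by rw [h]⟩
  · rintro ⟨x, hx, i, rfl⟩
    exact ⟨⟨x, hx, i, n, rfl⟩, length_factorWord _ _ _⟩

theorem finite_words [Finite A] (L : Language A) (n : ℕ) :
    {w : List A | w ∈ L ∧ w.length = n}.Finite :=
  (List.finite_length_eq A n).subset fun _ h => h.2

theorem langCount_shiftLanguage_add_le [Finite A] (X : Set (ℤ → A)) (m n : ℕ) :
    langCount (shiftLanguage X) (m + n) ≤
      langCount (shiftLanguage X) m * langCount (shiftLanguage X) n := by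
  unfold langCount
  rw [← Set.ncard_prod]
  refine Set.ncard_le_ncard_of_injOn (fun w => (w.take m, w.drop m)) ?_ ?_
    ((finite_words _ m).prod (finite_words _ n))
  · intro w hw
    obtain ⟨x, hx, i, rfl⟩ := mem_shiftLanguage_length.1 hw
    have h := length_factorWord x i m
    refine ⟨mem_shiftLanguage_length.2 ⟨x, hx, i, ?_⟩,
      mem_shiftLanguage_length.2 ⟨x, hx, i + m, ?_⟩⟩ <;> dsimp only <;> rw [factorWord_add]
    · exact List.take_left' h
    · exact List.drop_left' h
  · intro w _ w' _ h
    obtain ⟨h1, h2⟩ := Prod.mk.inj h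
    rw [← List.take_append_drop m w, h1, h2, List.take_append_drop]

theorem one_le_langCount_shiftLanguage [Finite A] {X : Set (ℤ → A)} (hX : X.Nonempty) (n : ℕ) :
    1 ≤ langCount (shiftLanguage X) n := by
  obtain ⟨x, hx⟩ := hX
  exact (Set.ncard_pos (finite_words _ n)).2
    ⟨factorWord x 0 n, mem_shiftLanguage_length.2 ⟨x, hx, 0, rfl⟩⟩

end FactorWord

/-! ### Generating functions with values in `[0, ∞]` -/

section WeightedSum

variable {A : Type*}

/-- The generating function of a language, as a sum over its words with values in `[0, ∞]`. -/
noncomputable def wordSum (L : Language A) (z : ℝ≥0∞) : ℝ≥0∞ :=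
  ∑' w : {w : List A // w ∈ L}, z ^ w.1.length

theorem wordSum_eq_tsum {ι : Type*} {L : Language A} (g : ι → List A) (hg : Function.Injective g)
    (hL : ∀ w, w ∈ L ↔ ∃ i, g i = w) (z : ℝ≥0∞) : wordSum L z = ∑' i, z ^ (g i).length := by
  let e : ι ≃ {w : List A // w ∈ L} :=
    Equiv.ofBijective (fun i => ⟨g i, (hL _).2 ⟨i, rfl⟩⟩)
      ⟨fun i j h => hg (congrArg Subtype.val h), fun w => by
        obtain ⟨i, hi⟩ := (hL _).1 w.2
        exact ⟨i, Subtype.ext hi⟩⟩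
  exact (e.tsum_eq fun w => z ^ w.1.length).symm

theorem wordSum_le_tsum {ι : Type*} {L : Language A} (g : ι → List A)
    (hL : ∀ w ∈ L, ∃ i, g i = w) (z : ℝ≥0∞) : wordSum L z ≤ ∑' i, z ^ (g i).length := by
  choose f hf using hL
  have h := ENNReal.tsum_comp_le_tsum_of_injective
    (f := fun w : {w : List A // w ∈ L} => f w.1 w.2)
    (fun w w' h => Subtype.ext (by rw [← hf w.1 w.2, ← hf w'.1 w'.2]; exact congrArg g h))
    (fun i => z ^ (g i).length)
  refine le_trans (le_of_eq ?_) h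
  exact tsum_congr fun w => by rw [hf w.1 w.2]

theorem wordSum_mul_wordSum (L L' : Language A) (z : ℝ≥0∞) :
    wordSum L z * wordSum L' z =
      ∑' p : {w : List A // w ∈ L} × {w : List A // w ∈ L'},
        z ^ (p.1.1.length + p.2.1.length) := by
  unfold wordSum
  rw [← ENNReal.tsum_mul_right, ENNReal.tsum_prod']
  refine tsum_congr fun p => ?_
  rw [← ENNReal.tsum_mul_left]
  exact tsum_congr fun q => (pow_add _ _ _).symm

theorem wordSum_mono {L L' : Language A} (h : ∀ w ∈ L, w ∈ L') (z : ℝ≥0∞) :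
    wordSum L z ≤ wordSum L' z :=
  ENNReal.tsum_comp_le_tsum_of_injective
    (f := fun w : {w : List A // w ∈ L} => (⟨w.1, h _ w.2⟩ : {w : List A // w ∈ L'}))
    (fun _ _ h => Subtype.ext (congrArg (fun w => w.1) h)) (fun w => z ^ w.1.length)

/-- Grouping by fibres. Applied to the length of words it produces `langCount`; applied to the range
of the edges leaving a vertex it produces the entries of `A_G`. -/
theorem tsum_comp_eq_tsum_card {α β : Type*} (f : α → β) (x : β → ℝ≥0∞)
    (hf : ∀ b, {a | f a = b}.Finite) :
    ∑' a, x (f a) = ∑' b, ({a | f a = b}.ncard : ℝ≥0∞) * x b := by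
  rw [← (Equiv.sigmaFiberEquiv f).tsum_eq, ENNReal.tsum_sigma']
  refine tsum_congr fun b => ?_
  have h : ∀ a : {a // f a = b}, x (f (Equiv.sigmaFiberEquiv f ⟨b, a⟩)) = x b := by
    rintro ⟨a, rfl⟩; rfl
  have : Finite {a // f a = b} := hf b
  rw [tsum_congr h, ENNReal.tsum_const]
  congr 1
  rw [ENat.card_eq_coe_natCard]
  rfl

theorem wordSum_eq_tsum_langCount [Finite A] (L : Language A) (z : ℝ≥0∞) :
    wordSum L z = ∑' n, (langCount L n : ℝ≥0∞) * z ^ n := by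
  have h : ∀ n, Subtype.val '' {w : {w : List A // w ∈ L} | w.1.length = n} =
      {w : List A | w ∈ L ∧ w.length = n} := by
    intro n
    ext w
    constructor
    · rintro ⟨⟨w, hw⟩, h, rfl⟩; exact ⟨hw, h⟩
    · rintro ⟨hw, h⟩; exact ⟨⟨w, hw⟩, h, rfl⟩
  unfold wordSum
  rw [tsum_comp_eq_tsum_card (fun w : {w : List A // w ∈ L} => w.1.length) (fun n => z ^ n)]
  · refine tsum_congr fun n => ?_
    unfold langCount
    rw [← h, Set.ncard_image_of_injective _ Subtype.val_injective]
  · intro n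
    refine Set.Finite.of_finite_image ?_ Subtype.val_injective.injOn
    rw [h]
    exact finite_words L n

theorem wordSum_ofReal [Finite A] (L : Language A) {z : ℝ} (hz : 0 ≤ z) :
    wordSum L (ENNReal.ofReal z) = ∑' n, ENNReal.ofReal ((langCount L n : ℝ) * z ^ n) := by
  rw [wordSum_eq_tsum_langCount]
  refine tsum_congr fun n => ?_
  rw [ENNReal.ofReal_mul (Nat.cast_nonneg _), ENNReal.ofReal_natCast, ENNReal.ofReal_pow hz]

theorem genFunConverges_iff [Finite A] (L : Language A) {z : ℝ} (hz : 0 ≤ z) :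
    GenFunConverges L z ↔ wordSum L (ENNReal.ofReal z) ≠ ∞ := by
  rw [wordSum_ofReal L hz]
  refine ⟨fun h => h.tsum_ofReal_ne_top, fun h => ?_⟩
  refine (ENNReal.summable_toReal h).congr fun n => ?_
  rw [ENNReal.toReal_ofReal (by positivity)]

theorem genFun_eq_toReal [Finite A] (L : Language A) {z : ℝ} (hz : 0 ≤ z) :
    genFun L z = (wordSum L (ENNReal.ofReal z)).toReal := by
  rw [wordSum_ofReal L hz, ENNReal.tsum_toReal_eq fun _ => ENNReal.ofReal_ne_top]
  refine tsum_congr fun n => ?_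
  rw [ENNReal.toReal_ofReal (by positivity)]

end WeightedSum

/-! ### Functional equations, and comparison with the shift language -/

namespace DirGraph

variable {V E : Type*} {G : DirGraph V E}

/-- A Dyck word is empty or is uniquely `e⁻ d e⁺ w` with `d` and `w` Dyck words at `r e` and `u`. In
`[0, ∞]` the identity needs no convergence. -/
theorem wordSum_dyckWords (u : V) (z : ℝ≥0∞) :
    wordSum (G.dyckWords u) z = 1 + z ^ 2 *
      (∑' e : {e // G.s e = u}, wordSum (G.dyckWords (G.r e)) z) * wordSum (G.dyckWords u) z := by
  let g : Unit ⊕ (Σ e : {e // G.s e = u},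
      {d // d ∈ G.dyckWords (G.r e)} × {d // d ∈ G.dyckWords u}) → List (Letter E) :=
    Sum.elim (fun _ => []) fun p => Letter.neg p.1.1 :: (p.2.1.1 ++ Letter.pos p.1.1 :: p.2.2.1)
  have hg : Function.Injective g := by
    rintro (_ | ⟨⟨e, he⟩, ⟨d, hd⟩, ⟨w, hw⟩⟩) (_ | ⟨⟨e', he'⟩, ⟨d', hd'⟩, ⟨w', hw'⟩⟩) h
    · rfl
    · exact (List.cons_ne_nil _ _ h.symm).elim
    · exact (List.cons_ne_nil _ _ h).elim
    · obtain ⟨h1, h2⟩ := List.cons.inj h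
      cases h1
      obtain ⟨rfl, rfl⟩ := dyck_append_pos_inj hd hd' h2
      rfl
  refine (wordSum_eq_tsum g hg ?_ z).trans ?_
  rotate_left
  · rw [Summable.tsum_sum ENNReal.summable ENNReal.summable]
    congr 1
    · simp [g]
    · rw [ENNReal.tsum_sigma', ← ENNReal.tsum_mul_left, ← ENNReal.tsum_mul_right]
      refine tsum_congr fun e => ?_
      rw [mul_assoc, wordSum_mul_wordSum, ← ENNReal.tsum_mul_left]
      refine tsum_congr fun p => ?_
      simp only [g, Sum.elim_inr, List.length_cons, List.length_append]
      ring
  · intro w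
    constructor
    · intro hw
      cases w with
      | nil => exact ⟨Sum.inl (), rfl⟩
      | cons a w =>
        obtain ⟨e, rfl, rfl, ⟨l, hl, -⟩ | ⟨d, w', rfl, hd, hw'⟩⟩ := Run.cases_nil hw
        · simp at hl
        · exact ⟨Sum.inr ⟨⟨e, rfl⟩, ⟨d, hd⟩, ⟨w', hw'⟩⟩, rfl⟩
    · rintro ⟨_ | ⟨⟨e, rfl⟩, ⟨d, hd⟩, ⟨w, hw⟩⟩, rfl⟩
      · exact nil_mem_dyckWords u
      · exact run_wrap hd hw

/-- The three terms are the empty word, a first letter `e⁻` that is never cancelled, and one that is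
cancelled after a Dyck word `d`. -/
theorem wordSum_readableWords (u : V) (z : ℝ≥0∞) :
    wordSum (G.readableWords u) z =
      1 + (z * (∑' e : {e // G.s e = u}, wordSum (G.readableWords (G.r e)) z) +
        z ^ 2 * (∑' e : {e // G.s e = u}, wordSum (G.dyckWords (G.r e)) z) *
          wordSum (G.readableWords u) z) := by
  let g : Unit ⊕ ((Σ e : {e // G.s e = u}, {w // w ∈ G.readableWords (G.r e)}) ⊕
      (Σ e : {e // G.s e = u},
        {d // d ∈ G.dyckWords (G.r e)} × {w // w ∈ G.readableWords u})) → List (Letter E) :=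
    Sum.elim (fun _ => []) <| Sum.elim (fun p => Letter.neg p.1.1 :: p.2.1)
      fun p => Letter.neg p.1.1 :: (p.2.1.1 ++ Letter.pos p.1.1 :: p.2.2.1)
  have hg : Function.Injective g := by
    rintro (_ | ⟨⟨e, he⟩, ⟨x, hx⟩⟩ | ⟨⟨e, he⟩, ⟨d, hd⟩, ⟨w, hw⟩⟩)
      (_ | ⟨⟨e', he'⟩, ⟨x', hx'⟩⟩ | ⟨⟨e', he'⟩, ⟨d', hd'⟩, ⟨w', hw'⟩⟩) h
    · rfl
    · exact (List.cons_ne_nil _ _ h.symm).elim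
    · exact (List.cons_ne_nil _ _ h.symm).elim
    · exact (List.cons_ne_nil _ _ h).elim
    · obtain ⟨h1, h2⟩ := List.cons.inj h
      cases h1
      dsimp only at h2
      subst h2
      rfl
    · obtain ⟨h1, h2⟩ := List.cons.inj h
      cases h1
      dsimp only at h2
      -- The two non-empty cases are disjoint: if `e⁻` is cancelled after `d'`, the tail cannot be
      -- read from an empty stack.
      exact (not_readable_append_pos hd' (h2 ▸ hx)).elim
    · exact (List.cons_ne_nil _ _ h).elim
    · obtain ⟨h1, h2⟩ := List.cons.inj h
      cases h1
      dsimp only at h2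
      exact (not_readable_append_pos hd (h2 ▸ hx')).elim
    · obtain ⟨h1, h2⟩ := List.cons.inj h
      cases h1
      obtain ⟨rfl, rfl⟩ := dyck_append_pos_inj hd hd' h2
      rfl
  refine (wordSum_eq_tsum g hg ?_ z).trans ?_
  rotate_left
  · rw [Summable.tsum_sum ENNReal.summable ENNReal.summable,
      Summable.tsum_sum ENNReal.summable ENNReal.summable]
    congr 1
    · simp [g]
    · congr 1
      · rw [ENNReal.tsum_sigma', ← ENNReal.tsum_mul_left]
        refine tsum_congr fun e => ?_
        rw [wordSum, ← ENNReal.tsum_mul_left]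
        refine tsum_congr fun w => ?_
        simp only [g, Sum.elim_inr, Sum.elim_inl, List.length_cons]
        ring
      · rw [ENNReal.tsum_sigma', ← ENNReal.tsum_mul_left, ← ENNReal.tsum_mul_right]
        refine tsum_congr fun e => ?_
        rw [mul_assoc, wordSum_mul_wordSum, ← ENNReal.tsum_mul_left]
        refine tsum_congr fun p => ?_
        simp only [g, Sum.elim_inr, List.length_cons, List.length_append]
        ring
  · intro w
    constructor
    · rintro ⟨t, hw⟩
      cases w with
      | nil => exact ⟨Sum.inl (), rfl⟩
      | cons a w =>
        obtain ⟨e, rfl, rfl, ⟨l, hl, hr⟩ | ⟨d, w', rfl, hd, hw'⟩⟩ := Run.cases_nil hw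
        · exact ⟨Sum.inr (Sum.inl ⟨⟨e, rfl⟩, ⟨w, _, hr⟩⟩), rfl⟩
        · exact ⟨Sum.inr (Sum.inr ⟨⟨e, rfl⟩, ⟨d, hd⟩, ⟨w', _, hw'⟩⟩), rfl⟩
    · rintro ⟨_ | ⟨⟨e, rfl⟩, ⟨w, t, hw⟩⟩ | ⟨⟨e, rfl⟩, ⟨d, hd⟩, ⟨w, t, hw⟩⟩, rfl⟩
      · exact ⟨_, rfl⟩
      · exact ⟨_, _, Step.neg e [], hw.append_stack [e]⟩
      · exact ⟨t, run_wrap hd hw⟩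

/-- Only an inequality, since the base vertex and the cut between the two readable factors need not
be unique. -/
theorem wordSum_shiftLanguage_le [Nonempty V] (z : ℝ≥0∞) :
    wordSum (shiftLanguage G.markovDyck) z ≤
      ∑' u, wordSum (G.readableWords u) z * wordSum (G.readableWords u) z := by
  let g : (Σ u : V, {w // w ∈ G.readableWords u} × {w // w ∈ G.readableWords u}) →
      List (Letter E) := fun p => flipWord p.2.1.1 ++ p.2.2.1
  refine (wordSum_le_tsum g ?_ z).trans (le_of_eq ?_)
  · rintro w ⟨x, hx, i, n, rfl⟩
    obtain ⟨u, p, hp, q, hq, h⟩ := exists_flipWord_append (hx i n)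
    exact ⟨⟨u, ⟨p, hp⟩, ⟨q, hq⟩⟩, h.symm⟩
  · rw [ENNReal.tsum_sigma']
    refine tsum_congr fun u => ?_
    rw [wordSum_mul_wordSum]
    refine tsum_congr fun p => ?_
    simp only [g, List.length_append, length_flipWord]

theorem run_factorWord {x : ℤ → Letter E} {σ : ℤ → V × List E}
    (h : ∀ i, G.Step (σ i) (x i) (σ (i + 1))) (i : ℤ) (n : ℕ) :
    G.Run (σ i) (factorWord x i n) (σ (i + n)) := by
  induction n generalizing i with
  | zero => rw [factorWord_zero]; simp
  | succ n ih =>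
    rw [factorWord_succ]
    refine ⟨_, h i, ?_⟩
    have := ih (i + 1)
    rwa [add_assoc, add_comm (1 : ℤ) n, ← Nat.cast_succ] at this

theorem exists_forward_run (hout : ∀ v, ∃ e, G.s e = v) {s t : V × List E} {w : List (Letter E)}
    (hw : G.Run s w t) : ∃ (x : ℕ → Letter E) (σ : ℕ → V × List E), σ 0 = s ∧
      (∀ n, G.Step (σ n) (x n) (σ (n + 1))) ∧ (List.ofFn fun k : Fin w.length => x k) = w := by
  induction w generalizing s with
  | nil =>
    have h : ∀ s : V × List E, ∃ a t, G.Step s a t := by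
      rintro ⟨v, l⟩
      obtain ⟨e, rfl⟩ := hout v
      exact ⟨_, _, Step.neg e l⟩
    choose f g hfg using h
    refine ⟨fun n => f (g^[n] s), fun n => g^[n] s, rfl, fun n => ?_, rfl⟩
    beta_reduce
    rw [Function.iterate_succ_apply']
    exact hfg _
  | cons a w ih =>
    obtain ⟨m, h1, h2⟩ := hw
    obtain ⟨x, σ, h0, hσ, hx⟩ := ih h2
    refine ⟨fun n => Nat.casesOn n a x, fun n => Nat.casesOn n s σ, rfl, ?_, ?_⟩
    · rintro (_ | n)
      · change G.Step s a (σ 0)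
        rwa [h0]
      · exact hσ n
    · simp only [List.length_cons, List.ofFn_succ, Fin.val_zero, Fin.val_succ, hx]
      rfl

/-- The run extends to the right by pushing forever. It extends to the left because every state at
`v` is entered by some `e⁺` with `s e = v`. Outgoing edges suffice for both. -/
theorem readableWords_subset_shiftLanguage (hout : ∀ v, ∃ e, G.s e = v) {u : V}
    {w : List (Letter E)} (hw : w ∈ G.readableWords u) : w ∈ shiftLanguage G.markovDyck := by
  obtain ⟨t, ht⟩ := hw
  obtain ⟨x, σ, h0, hσ, hx⟩ := exists_forward_run hout ht
  have h : ∀ t : V × List E, ∃ a s, G.Step s a t := by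
    rintro ⟨v, l⟩
    obtain ⟨e, rfl⟩ := hout v
    exact ⟨_, _, Step.pos e l⟩
  choose f g hfg using h
  -- `Int.negSucc n` is position `-(n + 1)`, so the state there is the `(n + 1)`-st predecessor of
  -- `(u, [])`, and the letter leads to the `n`-th one.
  let y : ℤ → Letter E
    | Int.ofNat n => x n
    | Int.negSucc n => f (g^[n] (u, []))
  let τ : ℤ → V × List E
    | Int.ofNat n => σ n
    | Int.negSucc n => g^[n + 1] (u, [])
  have hτ : ∀ i, G.Step (τ i) (y i) (τ (i + 1)) := by
    rintro (n | n)
    · exact hσ n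
    · cases n with
      | zero =>
        change G.Step (g (u, [])) (f (u, [])) (σ 0)
        rw [h0]
        exact hfg _
      | succ n =>
        change G.Step (g^[n + 1 + 1] (u, [])) (f (g^[n + 1] (u, []))) (g^[n + 1] (u, []))
        rw [Function.iterate_succ_apply' g (n + 1)]
        exact hfg _
  refine ⟨y, fun i n => wordProd_ne_zeroElt (run_factorWord hτ i n), 0, w.length, ?_⟩
  rw [← hx]
  simp only [factorWord, List.length_ofFn, zero_add]
  rfl

end DirGraph

/-! ### Convergence at the end point, and entropy as radius of convergence -/

section GenFun

variable {A : Type*} {L L' : Language A}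

theorem genFun_nonneg (L : Language A) {z : ℝ} (hz : 0 ≤ z) : 0 ≤ genFun L z :=
  tsum_nonneg fun _ => by positivity

theorem genFunConverges_mono [Finite A] (h : ∀ w ∈ L, w ∈ L') {z : ℝ} (hz : 0 ≤ z)
    (hL : GenFunConverges L' z) : GenFunConverges L z := by
  rw [genFunConverges_iff _ hz] at hL ⊢
  exact ne_top_of_le_ne_top hL (wordSum_mono h _)

/-- The partial sums are continuous and have non-negative terms, so the bound `c` passes to them at
`z`. -/
theorem genFunConverges_of_eventually_le {z c : ℝ} (hz : 0 < z)
    (h : ∀ᶠ y in 𝓝[<] z, GenFunConverges L y ∧ genFun L y ≤ c) : GenFunConverges L z := by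
  refine summable_of_sum_range_le (c := c) (fun n => by positivity) fun n => ?_
  have hc : Continuous fun y : ℝ => ∑ i ∈ Finset.range n, (langCount L i : ℝ) * y ^ i := by
    fun_prop
  refine le_of_tendsto (x := 𝓝[<] z) ((hc.tendsto z).mono_left nhdsWithin_le_nhds) ?_
  filter_upwards [h, Ioo_mem_nhdsLT hz] with y hy hy0
  have hpos := hy0.1
  exact (hy.1.sum_le_tsum _ fun i _ => by positivity).trans hy.2

theorem tendsto_genFun {z : ℝ} (hz : 0 < z) (h : GenFunConverges L z) :
    Tendsto (genFun L) (𝓝[<] z) (𝓝 (genFun L z)) := by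
  have hc : ContinuousOn (genFun L) (Set.Icc 0 z) := by
    refine continuousOn_tsum (fun n => by fun_prop) h fun n y hy => ?_
    have := hy.1
    rw [Real.norm_of_nonneg (by positivity)]
    gcongr
    exact hy.2
  exact (hc z (Set.right_mem_Icc.2 hz.le)).mono_left (nhdsWithin_le_of_mem (Icc_mem_nhdsLT hz))

/-- Fekete's lemma for the subadditive sequence of logarithms of the word counts. Since the limit is
also the infimum, the counts are at least `e^{nh}` for `n > 0`; hence the terms at `e^{-h}` do not
tend to zero. -/
theorem hasTopEntropy_lim [Finite A] {X : Set (ℤ → A)} (hX : X.Nonempty) :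
    ∃ h : ℝ, HasTopEntropy X h ∧
      (∀ z, 0 < z → z < Real.exp (-h) → GenFunConverges (shiftLanguage X) z) ∧
      ¬ GenFunConverges (shiftLanguage X) (Real.exp (-h)) := by
  set b : ℕ → ℝ := fun n => (langCount (shiftLanguage X) n : ℝ) with hb
  have hb1 : ∀ n, 1 ≤ b n := fun n => by
    simp only [hb]
    exact_mod_cast one_le_langCount_shiftLanguage hX n
  have hb0 : ∀ n, 0 < b n := fun n => one_pos.trans_le (hb1 n)
  have hsub : Subadditive fun n => Real.log (b n) := fun m n => by
    rw [← Real.log_mul (hb0 m).ne' (hb0 n).ne']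
    refine Real.log_le_log (hb0 _) ?_
    simp only [hb]
    exact_mod_cast langCount_shiftLanguage_add_le X m n
  have hbdd : BddBelow (Set.range fun n : ℕ => Real.log (b n) / n) := by
    refine ⟨0, ?_⟩
    rintro _ ⟨n, rfl⟩
    exact div_nonneg (Real.log_nonneg (hb1 n)) (Nat.cast_nonneg n)
  have hlim := hsub.tendsto_lim hbdd
  refine ⟨hsub.lim, ?_, fun z hz hz' => ?_, fun hs => ?_⟩
  · refine hlim.congr fun n => ?_
    ring
  · obtain ⟨k, hk, hk'⟩ := exists_between ((Real.log_lt_iff_lt_exp hz).2 hz')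
    have hlt : hsub.lim < -k := by linarith
    have hr : Real.exp (-k) * z < 1 := by
      rw [Real.log_lt_iff_lt_exp hz] at hk
      calc Real.exp (-k) * z < Real.exp (-k) * Real.exp k := by gcongr
        _ = 1 := by rw [← Real.exp_add]; simp
    refine Summable.of_norm_bounded_eventually_nat
      (summable_geometric_of_lt_one (by positivity) hr) ?_
    filter_upwards [hlim.eventually_lt_const hlt, eventually_gt_atTop 0] with n hn hn0
    have hn0' : (0 : ℝ) < n := by exact_mod_cast hn0
    rw [div_lt_iff₀ hn0', Real.log_lt_iff_lt_exp (hb0 n)] at hn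
    rw [Real.norm_of_nonneg (by positivity), mul_pow, ← Real.exp_nat_mul, mul_comm (n : ℝ)]
    gcongr
  · have h0 := hs.tendsto_atTop_zero
    have h1 : ∀ᶠ n : ℕ in atTop, (1 : ℝ) ≤ b n * Real.exp (-hsub.lim) ^ n := by
      filter_upwards [eventually_gt_atTop 0] with n hn
      have hn' : (0 : ℝ) < n := by exact_mod_cast hn
      have h2 := hsub.lim_le_div hbdd hn.ne'
      rw [le_div_iff₀ hn', Real.le_log_iff_exp_le (hb0 n)] at h2
      calc (1 : ℝ) = Real.exp (hsub.lim * n) * Real.exp (-hsub.lim) ^ n := by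
            rw [← Real.exp_nat_mul, ← Real.exp_add]; ring_nf; simp
        _ ≤ _ := by gcongr
    exact absurd (ge_of_tendsto h0 h1) (by norm_num)

end GenFun

/-- If `x = M x` with `x ≠ 0`, look at an index where `|x i| / w i` attains its maximum `c`: there
`c w = |x| ≤ c (M w) < c w`. -/
theorem Matrix.det_one_sub_ne_zero_of_mulVec_lt {ι : Type*} [Fintype ι] [DecidableEq ι]
    {M : Matrix ι ι ℝ} (hM : ∀ i j, 0 ≤ M i j) {w : ι → ℝ} (hw : ∀ i, 0 < w i)
    (h : ∀ i, (M *ᵥ w) i < w i) : (1 - M).det ≠ 0 := by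
  intro hdet
  obtain ⟨x, hx, hx0⟩ := Matrix.exists_mulVec_eq_zero_iff.2 hdet
  rw [Matrix.sub_mulVec, Matrix.one_mulVec, sub_eq_zero] at hx0
  obtain ⟨i₀, hi₀⟩ := Function.ne_iff.1 hx
  obtain ⟨u, -, hu⟩ := Finset.exists_max_image Finset.univ (fun i => |x i| / w i)
    ⟨i₀, Finset.mem_univ _⟩
  set c := |x u| / w u with hc
  have hle : ∀ i, |x i| ≤ c * w i := fun i => (div_le_iff₀ (hw i)).1 (hu i (Finset.mem_univ _))
  have hc0 : 0 < c := (div_pos (abs_pos.2 hi₀) (hw i₀)).trans_le (hu i₀ (Finset.mem_univ _))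
  have h1 : |x u| ≤ c * (M *ᵥ w) u := by
    conv_lhs => rw [hx0]
    simp only [Matrix.mulVec, dotProduct, Finset.mul_sum]
    refine (Finset.abs_sum_le_sum_abs _ _).trans (Finset.sum_le_sum fun j _ => ?_)
    rw [abs_mul, abs_of_nonneg (hM u j)]
    calc M u j * |x j| ≤ M u j * (c * w j) := mul_le_mul_of_nonneg_left (hle j) (hM u j)
      _ = c * (M u j * w j) := by ring
  have h2 : |x u| = c * w u := by rw [hc, div_mul_cancel₀ _ (hw u).ne']
  have h3 := mul_lt_mul_of_pos_left (h u) hc0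
  linarith

/-! ### The linear system for the readable words and its determinant -/

namespace DirGraph

variable {V E : Type*} {G : DirGraph V E}

instance [Finite E] : Finite (Letter E) :=
  Finite.of_surjective (Sum.elim Letter.neg Letter.pos : E ⊕ E → Letter E) (by
    rintro (e | e)
    · exact ⟨Sum.inl e, rfl⟩
    · exact ⟨Sum.inr e, rfl⟩)

theorem StronglyConnected.exists_source [Nonempty E] (hG : G.StronglyConnected) (v : V) :
    ∃ e, G.s e = v := by
  obtain ⟨e₀⟩ := ‹Nonempty E›
  rcases Relation.ReflTransGen.cases_head (hG v (G.s e₀)) with h | ⟨c, ⟨e, he, -⟩, -⟩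
  · exact ⟨e₀, h.symm⟩
  · exact ⟨e, he⟩

theorem StronglyConnected.exists_range [Nonempty E] (hG : G.StronglyConnected) (v : V) :
    ∃ e, G.r e = v := by
  obtain ⟨e₀⟩ := ‹Nonempty E›
  rcases Relation.ReflTransGen.cases_tail (hG (G.r e₀) v) with h | ⟨c, -, ⟨e, -, he⟩⟩
  · exact ⟨e₀, h.symm⟩
  · exact ⟨e, he⟩

theorem one_le_genFun_dyckWords [Finite E] {u : V} {z : ℝ} (hz : 0 ≤ z)
    (h : GenFunConverges (G.dyckWords u) z) : 1 ≤ genFun (G.dyckWords u) z := by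
  rw [genFun_eq_toReal _ hz, ← ENNReal.toReal_one]
  rw [genFunConverges_iff _ hz] at h
  refine ENNReal.toReal_mono h ?_
  rw [wordSum_dyckWords]
  exact le_self_add

/-- Keeping a single edge in the functional equation gives `z² D_{r e} D_{s e} ≤ D_{s e}`, and `D_{s
e}` is finite and at least `1`, so it cancels. The bound does not depend on the size of the series.
-/
theorem genFun_dyckWords_le [Finite E] {z : ℝ} (hz : 0 < z)
    (h : ∀ u, GenFunConverges (G.dyckWords u) z) (e : E) :
    genFun (G.dyckWords (G.r e)) z ≤ (z ^ 2)⁻¹ := by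
  have h1 := one_le_genFun_dyckWords hz.le (h (G.s e))
  have h2 : ENNReal.ofReal z ^ 2 * wordSum (G.dyckWords (G.r e)) (ENNReal.ofReal z) *
      wordSum (G.dyckWords (G.s e)) (ENNReal.ofReal z) ≤
        wordSum (G.dyckWords (G.s e)) (ENNReal.ofReal z) := by
    conv_rhs => rw [wordSum_dyckWords]
    refine le_add_left ?_
    gcongr
    exact ENNReal.le_tsum (f := fun f : {f // G.s f = G.s e} =>
      wordSum (G.dyckWords (G.r f)) (ENNReal.ofReal z)) ⟨e, rfl⟩
  have h3 := ENNReal.toReal_mono ((genFunConverges_iff _ hz.le).1 (h (G.s e))) h2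
  rw [ENNReal.toReal_mul, ENNReal.toReal_mul, ENNReal.toReal_pow, ENNReal.toReal_ofReal hz.le,
    ← genFun_eq_toReal _ hz.le, ← genFun_eq_toReal _ hz.le] at h3
  rw [← one_div, le_div_iff₀ (by positivity), mul_comm]
  exact le_of_mul_le_mul_right (by rwa [one_mul]) (one_pos.trans_le h1)

theorem genFun_readableWords [Finite E] [Fintype V] {z : ℝ} (hz : 0 ≤ z)
    (h : ∀ u, GenFunConverges (G.readableWords u) z) (u : V) :
    genFun (G.readableWords u) z = genFun (G.dyckWords u) z *
      (1 + z * ∑ v, G.adjMatrix u v * genFun (G.readableWords v) z) := by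
  have hW : ∀ v, wordSum (G.readableWords v) (ENNReal.ofReal z) ≠ ∞ := fun v =>
    (genFunConverges_iff _ hz).1 (h v)
  have hD : wordSum (G.dyckWords u) (ENNReal.ofReal z) ≠ ∞ :=
    ne_top_of_le_ne_top (hW u) (wordSum_mono (fun _ => dyckWords_subset_readableWords) _)
  have hA : ∀ v, {e : {e // G.s e = u} | G.r e = v}.ncard =
      {e : E | G.s e = u ∧ G.r e = v}.ncard := by
    intro v
    rw [← Set.ncard_image_of_injective _ Subtype.val_injective]
    congr 1
    ext e
    constructor
    · rintro ⟨⟨e, he⟩, h, rfl⟩; exact ⟨he, h⟩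
    · rintro ⟨he, h⟩; exact ⟨⟨e, he⟩, h, rfl⟩
  have hsum := tsum_comp_eq_tsum_card (fun e : {e // G.s e = u} => G.r e)
    (fun v => wordSum (G.readableWords v) (ENNReal.ofReal z)) fun _ => Set.toFinite _
  rw [tsum_fintype (L := .unconditional V)] at hsum
  have eD := wordSum_dyckWords (G := G) u (ENNReal.ofReal z)
  have eW := wordSum_readableWords (G := G) u (ENNReal.ofReal z)
  rw [hsum] at eW
  set K := ENNReal.ofReal z ^ 2 *
    ∑' e : {e // G.s e = u}, wordSum (G.dyckWords (G.r e)) (ENNReal.ofReal z)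
  have hKD : K * wordSum (G.dyckWords u) (ENNReal.ofReal z) ≠ ∞ := fun hi =>
    hD (by rw [eD, hi, add_top])
  have hKW : K * wordSum (G.readableWords u) (ENNReal.ofReal z) ≠ ∞ := fun hi =>
    hW u (by rw [eW, hi, add_top, add_top])
  have hAW : ∀ v, ({e : {e // G.s e = u} | G.r e = v}.ncard : ℝ≥0∞) *
      wordSum (G.readableWords v) (ENNReal.ofReal z) ≠ ∞ := fun v =>
    ENNReal.mul_ne_top (ENNReal.natCast_ne_top _) (hW v)
  have hS := ENNReal.mul_ne_top (ENNReal.ofReal_ne_top (r := z))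
    (ENNReal.sum_ne_top.2 fun v (_ : v ∈ Finset.univ) => hAW v)
  replace eD := congrArg ENNReal.toReal eD
  replace eW := congrArg ENNReal.toReal eW
  rw [ENNReal.toReal_add ENNReal.one_ne_top hKD, ENNReal.toReal_mul, ENNReal.toReal_one,
    ← genFun_eq_toReal _ hz] at eD
  rw [ENNReal.toReal_add ENNReal.one_ne_top (ENNReal.add_ne_top.2 ⟨hS, hKW⟩),
    ENNReal.toReal_add hS hKW, ENNReal.toReal_mul, ENNReal.toReal_mul, ENNReal.toReal_one,
    ← genFun_eq_toReal _ hz, ENNReal.toReal_ofReal hz,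
    ENNReal.toReal_sum fun v _ => hAW v] at eW
  have hsum' : ∑ v, (({e : {e // G.s e = u} | G.r e = v}.ncard : ℝ≥0∞) *
      wordSum (G.readableWords v) (ENNReal.ofReal z)).toReal =
      ∑ v, G.adjMatrix u v * genFun (G.readableWords v) z := by
    refine Finset.sum_congr rfl fun v _ => ?_
    rw [ENNReal.toReal_mul, ENNReal.toReal_natCast, ← genFun_eq_toReal _ hz, hA]
    rfl
  rw [hsum'] at eW
  -- With `D = 1 + K D` and `W = 1 + z S + K W`, the terms `K D W` cancel, leaving `W = D (1 + z
  -- S)`.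
  linear_combination genFun (G.dyckWords u) z * eW - genFun (G.readableWords u) z * eD

theorem dStar_eq [DecidableEq V] (z : ℝ) :
    G.dStar z = Matrix.diagonal fun v => genFun (G.dyckWords v) z := by
  simp only [dStar, kstar_dyckCode]

variable [Fintype V] [DecidableEq V]

theorem dStar_mul_apply (z : ℝ) (u v : V) : (G.dStar z * (z • G.adjMatrix)) u v =
    genFun (G.dyckWords u) z * (z * G.adjMatrix u v) := by
  rw [dStar_eq, Matrix.diagonal_mul, Matrix.smul_apply, smul_eq_mul]

theorem dStar_mul_mulVec [Finite E] {z : ℝ} (hz : 0 ≤ z)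
    (h : ∀ u, GenFunConverges (G.readableWords u) z) :
    (1 - G.dStar z * (z • G.adjMatrix)) *ᵥ (fun u => genFun (G.readableWords u) z) =
      fun u => genFun (G.dyckWords u) z := by
  ext u
  rw [Matrix.sub_mulVec, Matrix.one_mulVec, Pi.sub_apply, genFun_readableWords hz h u]
  simp only [Matrix.mulVec, dotProduct, dStar_mul_apply]
  rw [mul_add, mul_one, Finset.mul_sum, Finset.mul_sum, add_sub_assoc, ← Finset.sum_sub_distrib,
    Finset.sum_eq_zero, add_zero]
  intro v _
  ring

/-- The vector `W` is a positive test vector: `W - M W = D ≥ 1` for the non-negative matrix `M = D^*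
A z`. -/
theorem det_ne_zero_of_converges [Finite E] {z : ℝ} (hz : 0 ≤ z)
    (h : ∀ u, GenFunConverges (G.readableWords u) z) :
    (1 - G.dStar z * (z • G.adjMatrix)).det ≠ 0 := by
  have hD : ∀ u, 1 ≤ genFun (G.dyckWords u) z := fun u => one_le_genFun_dyckWords hz
    (genFunConverges_mono (fun _ => dyckWords_subset_readableWords) hz (h u))
  have hM : ∀ u v, 0 ≤ (G.dStar z * (z • G.adjMatrix)) u v := fun u v => by
    rw [dStar_mul_apply]
    have h1 : 0 ≤ G.adjMatrix u v := Nat.cast_nonneg _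
    have h2 := one_pos.trans_le (hD u)
    positivity
  have hlt : ∀ u, ((G.dStar z * (z • G.adjMatrix)) *ᵥ
      fun u => genFun (G.readableWords u) z) u < genFun (G.readableWords u) z := fun u => by
    have h1 := congrFun (dStar_mul_mulVec hz h) u
    rw [Matrix.sub_mulVec, Matrix.one_mulVec, Pi.sub_apply] at h1
    linarith [hD u]
  refine Matrix.det_one_sub_ne_zero_of_mulVec_lt hM (fun u => ?_) hlt
  refine lt_of_le_of_lt ?_ (hlt u)
  exact Finset.sum_nonneg fun v _ => mul_nonneg (hM u v) (genFun_nonneg _ hz)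

/-- If the generating functions of the readable words converge to the left of `z`, and the
determinant does not vanish at `z`, then they also converge at `z`. -/
theorem readableWords_converges_of_det_ne_zero [Finite E] {z : ℝ} (hz : 0 < z)
    (hD : ∀ u, GenFunConverges (G.dyckWords u) z)
    (hW : ∀ y, 0 < y → y < z → ∀ u, GenFunConverges (G.readableWords u) y)
    (hdet : (1 - G.dStar z * (z • G.adjMatrix)).det ≠ 0) (u : V) :
    GenFunConverges (G.readableWords u) z := by
  let d : ℝ → V → ℝ := fun y v => genFun (G.dyckWords v) y
  let F : (V → ℝ) × ℝ → Matrix V V ℝ := fun p => 1 - Matrix.diagonal p.1 * (p.2 • G.adjMatrix)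
  have hF : Continuous F := by
    refine continuous_const.sub (Continuous.matrix_mul ?_ ?_)
    · exact continuous_fst.matrix_diagonal
    · exact continuous_snd.smul continuous_const
  have hFe : ∀ y, F (d y, y) = 1 - G.dStar y * (y • G.adjMatrix) := fun y => by
    rw [dStar_eq]
  have hd : Tendsto (fun y => (d y, y)) (𝓝[<] z) (𝓝 (d z, z)) :=
    (tendsto_pi_nhds.2 fun v => tendsto_genFun hz (hD v)).prodMk_nhds
      (tendsto_id.mono_left nhdsWithin_le_nhds)
  have hdet' := ((hF.matrix_det).tendsto (d z, z)).comp hd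
  have hadj : Continuous fun p : (V → ℝ) × ℝ => ((F p).adjugate *ᵥ p.1) u :=
    (continuous_apply u).comp (hF.matrix_adjugate.matrix_mulVec continuous_fst)
  -- By Cramer's rule, this quotient is `W_u(y)` for `y < z`. Its finite limit at `z` bounds `W_u`
  -- from the left.
  have hlim := ((hadj.tendsto (d z, z)).comp hd).div hdet' (by rw [hFe]; exact hdet)
  refine genFunConverges_of_eventually_le
    (c := ((F (d z, z)).adjugate *ᵥ d z) u / (F (d z, z)).det + 1) hz ?_
  filter_upwards [hlim.eventually_lt_const (lt_add_one _), Ioo_mem_nhdsLT hz] with y hy hy0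
  have hWy := hW y hy0.1 hy0.2
  refine ⟨hWy u, ?_⟩
  refine le_trans (le_of_eq ?_) hy.le
  have hne := det_ne_zero_of_converges hy0.1.le hWy
  have h1 := dStar_mul_mulVec hy0.1.le hWy
  rw [← hFe] at hne h1
  simp only [Function.comp_apply, Pi.div_apply]
  rw [eq_div_iff hne]
  change _ = ((F (d y, y)).adjugate *ᵥ fun u => genFun (G.dyckWords u) y) u
  rw [← h1, Matrix.mulVec_mulVec, Matrix.adjugate_mul, Matrix.smul_mulVec, Matrix.one_mulVec,
    Pi.smul_apply, smul_eq_mul, mul_comm]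

end DirGraph

/-! ### The smallest positive solution is `e^{-h}` -/

theorem corollary3p2 {V E : Type*} [Fintype V] [DecidableEq V] [Finite E] [Nonempty E]
    (G : DirGraph V E) (hG : G.StronglyConnected) :
    ∃ z : ℝ, IsLeast G.positiveSolutions z ∧ HasTopEntropy G.markovDyck (-Real.log z) := by
  have hout := hG.exists_source
  have hin := hG.exists_range
  have hV : Nonempty V := ‹Nonempty E›.map G.s
  have hX : G.markovDyck.Nonempty := by
    obtain ⟨u⟩ := hV
    obtain ⟨x, hx, -⟩ := DirGraph.readableWords_subset_shiftLanguage (G := G) hout (u := u)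
      (w := []) ⟨_, rfl⟩
    exact ⟨x, hx⟩
  obtain ⟨h, hh, hconv, hdiv⟩ := hasTopEntropy_lim hX
  set z := Real.exp (-h)
  have hz : 0 < z := Real.exp_pos _
  have hW : ∀ y, 0 < y → y < z → ∀ u, GenFunConverges (G.readableWords u) y :=
    fun y hy hyz u => genFunConverges_mono
      (fun _ => DirGraph.readableWords_subset_shiftLanguage hout) hy.le (hconv y hy hyz)
  have hD : ∀ u, GenFunConverges (G.dyckWords u) z := fun u => by
    obtain ⟨e, rfl⟩ := hin u
    -- For `z / 2 < y < z` the bound `y⁻²` on the Dyck series is at most `(z / 2)⁻²`. It reaches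
    -- every vertex because each one is the range of an edge.
    refine genFunConverges_of_eventually_le (c := ((z / 2) ^ 2)⁻¹) hz ?_
    filter_upwards [Ioo_mem_nhdsLT (half_lt_self hz)] with y hy
    have hy0 : 0 < y := (half_pos hz).trans hy.1
    have hDy : ∀ v, GenFunConverges (G.dyckWords v) y := fun v => genFunConverges_mono
      (fun _ => DirGraph.dyckWords_subset_readableWords) hy0.le (hW y hy0 hy.2 v)
    refine ⟨hDy _, (DirGraph.genFun_dyckWords_le hy0 hDy e).trans ?_⟩
    gcongr
    exact hy.1.le
  refine ⟨z, ⟨⟨hz, fun v => ?_, ?_⟩, ?_⟩, ?_⟩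
  · rw [DirGraph.kstar_dyckCode]
    exact hD v
  · by_contra hdet
    -- If all `W_u` converged at `z = e^{-h}`, the finite sum `∑ W_u²` would dominate the divergent
    -- series of the shift language.
    have hWz := DirGraph.readableWords_converges_of_det_ne_zero hz hD hW hdet
    refine hdiv ((genFunConverges_iff _ hz.le).2 ?_)
    refine ne_top_of_le_ne_top ?_ (DirGraph.wordSum_shiftLanguage_le _)
    rw [tsum_fintype]
    refine ENNReal.sum_ne_top.2 fun u _ => ?_
    have h1 := (genFunConverges_iff _ hz.le).1 (hWz u)
    exact ENNReal.mul_ne_top h1 h1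
  · rintro y ⟨hy, -, hdet⟩
    by_contra hlt
    exact DirGraph.det_ne_zero_of_converges hy.le (hW y hy (not_le.1 hlt)) hdet
  · rwa [Real.log_exp, neg_neg]
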